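/- Let $\mathcal{P}$ be the set of all (nonempty) permutations of finite length, partially ordered by pattern containment: $\sigma\le\pi$ if some subsequence of $\pi$ has the same relative order of size as the letters of $\sigma$. Let $\mu$ be the Möbius function of $\mathcal{P}$, i.e. $\mu(\sigma,\lambda)=0$ if $\sigma\not\le\lambda$, $\mu(\sigma,\sigma)=1$, and $\mu(\sigma,\lambda)=-\sum_{\sigma\le z<\lambda}\mu(\sigma,z)$ for $\sigma<\lambda$; write $\mu(\pi)=\mu(1,\pi)$, where $1$ is the permutation of length one. Then the function $\pi\mapsto\mu(\pi)$ is unbounded on $\mathcal{P}$: for every $B$ there is $\pi\in\mathcal{P}$ with $|\mu(\pi)|>B$. For example, for every $n\ge 1$ the permutation $M_n=2\,4\,6\ldots(2n)\,1\,3\,5\ldots(2n-1)$ of length $2n$ satisfies $$\mu(M_n)=-\binom{n+1}{2}.$$ -/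

import Mathlib

/-- A (nonempty) permutation of arbitrary finite length, in zero-based one-line notation:
position `i` holds the letter `perm i`. -/
@[ext] structure FinPermutation where
  /-- The number of letters. -/
  length : ℕ
  length_pos : 0 < length
  /-- The word of the permutation, as a bijection from positions to letters. -/
  perm : Equiv.Perm (Fin length)

namespace FinPermutation

/-- `σ ≤ π` means that `σ` occurs as a pattern in `π`: there are increasing positions `e 0 < e 1 < …`
in `π` at which the letters of `π` have the same relative order of size as the letters of `σ`. -/
instance : LE FinPermutation where
  le σ π := ∃ e : Fin σ.length ↪o Fin π.length,
    ∀ i j, σ.perm i < σ.perm j ↔ π.perm (e i) < π.perm (e j)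

theorem le_def {σ π : FinPermutation} : σ ≤ π ↔ ∃ e : Fin σ.length ↪o Fin π.length,
    ∀ i j, σ.perm i < σ.perm j ↔ π.perm (e i) < π.perm (e j) := Iff.rfl

theorem length_le {σ π : FinPermutation} (h : σ ≤ π) : σ.length ≤ π.length := by
  obtain ⟨e, -⟩ := h
  simpa using Fintype.card_le_of_injective e e.injective

/-- The poset of all permutations, ordered by pattern containment. -/
instance : PartialOrder FinPermutation where
  le_refl σ := ⟨RelEmbedding.refl _, fun _ _ => Iff.rfl⟩
  le_trans σ τ π := by
    rintro ⟨e, he⟩ ⟨f, hf⟩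
    exact ⟨e.trans f, fun i j => (he i j).trans (hf (e i) (e j))⟩
  le_antisymm := by
    intro σ π h h'
    have hl : σ.length = π.length := le_antisymm (length_le h) (length_le h')
    obtain ⟨n, hn, s⟩ := σ
    obtain ⟨m, hm, p⟩ := π
    obtain rfl : n = m := hl
    obtain ⟨e, he⟩ := h
    have hid : ∀ f : Fin n ↪o Fin n, ∀ i, f i = i := by
      intro f i
      have hs := (Finite.injective_iff_surjective (f := f)).1 f.injective
      have : RelIso.ofSurjective f hs = OrderIso.refl (Fin n) := Subsingleton.elim _ _
      exact congrArg (fun g : Fin n ≃o Fin n => g i) this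
    have he' : ∀ i j, s i < s j ↔ p i < p j := by
      intro i j
      have := he i j
      rwa [hid e i, hid e j] at this
    have hmono : StrictMono (fun x => p (s.symm x)) := by
      intro x y hxy
      exact (he' _ _).1 (by simpa using hxy)
    have hsp : ∀ i, p i = s i := by
      intro i
      simpa using hid (OrderEmbedding.ofStrictMono _ hmono) (s i)
    have : s = p := Equiv.ext fun i => (hsp i).symm
    subst this
    rfl

theorem finite_Iic (π : FinPermutation) : (Set.Iic π).Finite := by
  let f : (Σ n : Fin (π.length + 1), Equiv.Perm (Fin n)) → FinPermutation := fun x =>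
    if h : 0 < (x.1 : ℕ) then ⟨x.1, h, x.2⟩ else π
  refine (Set.finite_range f).subset ?_
  intro σ hσ
  refine ⟨⟨⟨σ.length, Nat.lt_succ_of_le (length_le hσ)⟩, σ.perm⟩, ?_⟩
  exact dif_pos σ.length_pos

noncomputable instance : LocallyFiniteOrder FinPermutation :=
  LocallyFiniteOrder.ofFiniteIcc fun _ b => (finite_Iic b).subset Set.Icc_subset_Iic_self

noncomputable instance : DecidableEq FinPermutation := Classical.decEq _

/-- The permutation `1` of length one. -/
instance : One FinPermutation := ⟨⟨1, Nat.one_pos, 1⟩⟩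

/-- The Möbius value `μ(π) = μ(1, π)`, where `μ` is the Möbius function of the poset of all
permutations. -/
noncomputable def mobius (π : FinPermutation) : ℤ := IncidenceAlgebra.mu ℤ 1 π

/-- The permutation `M_n = 2 4 6 … (2n) 1 3 5 … (2n-1)`, with positions and letters
counted from zero: the word `1 3 5 … (2n-1) 0 2 4 … (2n-2)`. -/
def evensThenOdds (n : ℕ) (hn : 1 ≤ n) : FinPermutation where
  length := 2 * n
  length_pos := by omega
  perm :=
    { toFun := fun i => if h : (i : ℕ) < n then ⟨2 * i + 1, by omega⟩ else ⟨2 * (i - n), by omega⟩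
      invFun := fun v => if (v : ℕ) % 2 = 1 then ⟨v / 2, by omega⟩ else ⟨n + v / 2, by omega⟩
      left_inv := by
        intro i
        ext
        dsimp only
        split_ifs <;> simp_all <;> omega
      right_inv := by
        intro v
        obtain ⟨v, hv⟩ := v
        rcases Nat.mod_two_eq_zero_or_one v with h | h
        · simp [h]; omega
        · have : v / 2 < n := by omega
          simp [h, this]; omega }

end FinPermutation

/-! A binary word `w` encodes the permutation `ofWord w` listing the indices of its 0s (`false`) and
then those of its 1s (`true`); `M_n` comes from (10)^n. The patterns of `ofWord w` are exactly the
permutations of its nonempty subwords. A word containing 10 can be recovered from its permutation,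
while the others give identities, which form a chain. Split the relation that `mobius` sums to 0
over `[1, ofWord w]` according to whether the pattern 21 is contained. The part avoiding 21 is an
interval of the chain and contributes 0, unless `w` = 10, when it is {1} and contributes 1. Hence,
on words containing 10, -`mobius` satisfies the recursion defining the subword Möbius function
`μ(10, ·)` (`mobius_ofWord`). Björner's formula (`sum_signedNormalEmbeddings`) evaluates that
function by signed normal embeddings. In (10)^n no letter repeats its predecessor, so every
embedding of 10 is normal, the sign is (-1)^(2n-2) = 1, and the count is the number of pairs i ≤ j
of blocks. -/

/-! ### Björner's formula for the subword order on binary words. -/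

/-- The signed number of normal embeddings of the word `β` into the word `u`, where `c` is the
letter that precedes `u`: an embedding is normal if it uses every letter of `u` that equals the
letter before it. The sign is the parity of the number of unused letters. -/
def signedNormalEmbeddings : Option Bool → List Bool → List Bool → ℤ
  | _, [], [] => 1
  | _, _ :: _, [] => 0
  | c, [], a :: u => if c = some a then 0 else -signedNormalEmbeddings (some a) [] u
  | c, b :: β, a :: u =>
    (if c = some a then 0 else -signedNormalEmbeddings (some a) (b :: β) u) +
      if b = a then signedNormalEmbeddings (some a) β u else 0

/-- The finite set of distinct subwords of a word. -/
def subwords (w : List Bool) : Finset (List Bool) := w.sublists.toFinset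

@[simp] theorem mem_subwords {u w : List Bool} : u ∈ subwords w ↔ u.Sublist w := by
  simp [subwords]

/-- The sum of `f` over the subwords of `w` that begin with the letter `a`. -/
def sumSubwordsFrom (f : List Bool → ℤ) (a : Bool) (w : List Bool) : ℤ :=
  ∑ u ∈ (subwords w).filter (fun u => u.head? = some a), f u

theorem sum_subwords (f : List Bool → ℤ) (w : List Bool) :
    ∑ u ∈ subwords w, f u = f [] + (sumSubwordsFrom f true w + sumSubwordsFrom f false w) := by
  have h : subwords w = insert [] ((subwords w).filter (fun u => u.head? = some true) ∪
      (subwords w).filter (fun u => u.head? = some false)) := by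
    ext u
    rcases u with _ | ⟨_ | _, u⟩ <;> simp
  rw [h, Finset.sum_insert (by simp), Finset.sum_union]
  · rfl
  · rw [Finset.disjoint_left]
    intro u hu hu'
    rw [Finset.mem_filter] at hu hu'
    have := hu.2.symm.trans hu'.2
    simp at this

theorem sumSubwordsFrom_nil (f : List Bool → ℤ) (a : Bool) : sumSubwordsFrom f a [] = 0 := by
  refine Finset.sum_eq_zero fun u hu => ?_
  simp only [Finset.mem_filter, mem_subwords, List.sublist_nil] at hu
  simp [hu.1] at hu

theorem sumSubwordsFrom_cons_self (f : List Bool → ℤ) (a : Bool) (w : List Bool) :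
    sumSubwordsFrom f a (a :: w) = ∑ u ∈ subwords w, f (a :: u) := by
  symm
  refine Finset.sum_bij (fun u _ => a :: u) (by simp) (by simp) ?_ (by simp)
  rintro (_ | ⟨b, u⟩) hu
  · simp at hu
  · simp only [Finset.mem_filter, mem_subwords, List.head?_cons, Option.some.injEq] at hu
    obtain ⟨hu, rfl⟩ := hu
    exact ⟨u, by simpa using hu, rfl⟩

theorem sumSubwordsFrom_cons_of_ne (f : List Bool → ℤ) {a b : Bool} (h : a ≠ b) (w : List Bool) :
    sumSubwordsFrom f a (b :: w) = sumSubwordsFrom f a w := by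
  refine Finset.sum_congr ?_ fun _ _ => rfl
  ext u
  rcases u with _ | ⟨c, u⟩
  · simp
  · simp only [Finset.mem_filter, mem_subwords, List.head?_cons, Option.some.injEq]
    refine and_congr_left ?_
    rintro rfl
    constructor
    · intro hu
      cases hu with
      | cons _ hu => exact hu
      | cons_cons _ hu => exact absurd rfl h
    · exact fun hu => hu.cons _

theorem indicator_suffix_cons (a : Bool) (β w : List Bool) :
    (if β <:+ a :: w then (1 : ℤ) else 0) =
      (if a :: w = β then 1 else 0) + if β <:+ w then 1 else 0 := by
  simp only [List.suffix_cons_iff]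
  by_cases h : a :: w = β
  · subst h
    have : ¬ a :: w <:+ w := fun h => by simpa using h.length_le
    simp [this]
  · simp [h, Ne.symm h]

theorem indicator_cons_suffix_cons (a : Bool) (β w : List Bool) :
    (if a :: β <:+ a :: w then (1 : ℤ) else 0) =
      (if w = β then 1 else 0) + if a :: β <:+ w then 1 else 0 := by
  rw [indicator_suffix_cons]
  simp

theorem cons_suffix_cons_of_ne {a b : Bool} (h : a ≠ b) (β w : List Bool) :
    a :: β <:+ b :: w ↔ a :: β <:+ w := by
  rw [List.suffix_cons_iff]
  simp [h]

/-- The closed form of the sum of `signedNormalEmbeddings c β` over the subwords of `w` that begin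
with `a`. -/
def sumFromClosedForm (c : Option Bool) (β : List Bool) (a : Bool) (w : List Bool) : ℤ :=
  (if c = some a then 0 else -if a :: β <:+ w then 1 else 0) +
    if β.head? = some a ∧ β <:+ w then 1 else 0

/-- The closed form of the sum of `signedNormalEmbeddings c β` over the subwords of `w`. -/
def sumClosedForm (c : Option Bool) (β w : List Bool) : ℤ :=
  (if w = β then 1 else 0) + if (∃ a, c = some a ∧ a :: β <:+ w) then 1 else 0

/-- A proper suffix is preceded in `w` by exactly one letter. -/
theorem indicator_suffix (β w : List Bool) :
    (if β <:+ w then (1 : ℤ) else 0) = (if w = β then 1 else 0) +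
      ((if true :: β <:+ w then 1 else 0) + if false :: β <:+ w then 1 else 0) := by
  induction w with
  | nil =>
    rcases β with _ | ⟨b, β⟩ <;> simp
  | cons a w ih =>
    rw [indicator_suffix_cons, ih]
    cases a
    · rw [indicator_cons_suffix_cons]
      simp only [cons_suffix_cons_of_ne (show true ≠ false by decide)]
      ring
    · rw [indicator_cons_suffix_cons]
      simp only [cons_suffix_cons_of_ne (show false ≠ true by decide)]
      ring

theorem sumClosedForm_eq (c : Option Bool) (β w : List Bool) :
    sumClosedForm c β w = signedNormalEmbeddings c β [] +
      (sumFromClosedForm c β true w + sumFromClosedForm c β false w) := by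
  have h := indicator_suffix β w
  unfold sumClosedForm sumFromClosedForm
  rcases β with _ | ⟨_ | _, β⟩ <;> rcases c with _ | _ | _ <;>
    simp [signedNormalEmbeddings] at h ⊢ <;> linarith

/-- Either the leading `a` is unused, or it is matched with the head of `β`; in both cases the rest
is a sum over the subwords of `w` with preceding letter `some a`, known from `ih`. -/
theorem sum_signedNormalEmbeddings_cons (c : Option Bool) (β : List Bool) (a : Bool)
    (w : List Bool)
    (ih : ∀ c β, ∑ u ∈ subwords w, signedNormalEmbeddings c β u = sumClosedForm c β w) :
    ∑ u ∈ subwords w, signedNormalEmbeddings c β (a :: u) =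
      sumFromClosedForm c β a (a :: w) := by
  have h1 := ih (some a) β
  rcases β with _ | ⟨b, β⟩
  · simp only [signedNormalEmbeddings, sumFromClosedForm]
    rw [indicator_cons_suffix_cons]
    split_ifs with hc <;> simp_all [sumClosedForm]
  · simp only [signedNormalEmbeddings, sumFromClosedForm, Finset.sum_add_distrib]
    rw [indicator_cons_suffix_cons]
    congr 1
    · split_ifs with hc <;> simp_all [sumClosedForm]
    · by_cases hb : b = a
      · subst hb
        have h2 := ih (some b) β
        have h3 := indicator_cons_suffix_cons b β w
        simp_all [sumClosedForm]
      · simp [hb]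

/-- Grouping by first letter counts each distinct subword once: those of `b :: w` starting with `b`
are `b :: u` with `u` a subword of `w`, and those starting with the other letter are already
subwords of `w`. The preceding letter `c` must stay arbitrary, since removing a first letter changes
it. -/
theorem sum_signedNormalEmbeddings_aux (w : List Bool) :
    (∀ c β, ∑ u ∈ subwords w, signedNormalEmbeddings c β u = sumClosedForm c β w) ∧
      ∀ c β a, sumSubwordsFrom (signedNormalEmbeddings c β) a w = sumFromClosedForm c β a w := by
  induction w with
  | nil =>
    have h : ∀ c β a, sumSubwordsFrom (signedNormalEmbeddings c β) a [] =
        sumFromClosedForm c β a [] := by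
      intro c β a
      rw [sumSubwordsFrom_nil]
      rcases β with _ | ⟨b, β⟩ <;> simp [sumFromClosedForm]
    refine ⟨fun c β => ?_, h⟩
    rw [sum_subwords, h, h, sumClosedForm_eq]
  | cons b w ih =>
    have h : ∀ c β a, sumSubwordsFrom (signedNormalEmbeddings c β) a (b :: w) =
        sumFromClosedForm c β a (b :: w) := by
      intro c β a
      by_cases hab : a = b
      · subst hab
        rw [sumSubwordsFrom_cons_self, sum_signedNormalEmbeddings_cons c β a w ih.1]
      · rw [sumSubwordsFrom_cons_of_ne _ hab, ih.2]
        unfold sumFromClosedForm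
        simp only [cons_suffix_cons_of_ne hab]
        rcases β with _ | ⟨d, β⟩
        · simp
        · by_cases hd : d = a
          · subst hd
            simp only [cons_suffix_cons_of_ne hab]
          · simp [hd]
    refine ⟨fun c β => ?_, h⟩
    rw [sum_subwords, h, h, sumClosedForm_eq]

/-- Björner's formula: `signedNormalEmbeddings none β` is the Möbius function `μ(β, ·)` of the
subword order. -/
theorem sum_signedNormalEmbeddings (β w : List Bool) :
    ∑ u ∈ subwords w, signedNormalEmbeddings none β u = if w = β then 1 else 0 := by
  rw [(sum_signedNormalEmbeddings_aux w).1]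
  simp [sumClosedForm]

theorem signedNormalEmbeddings_eq_zero (u : List Bool) :
    ∀ (c : Option Bool) (β : List Bool), ¬ β.Sublist u → signedNormalEmbeddings c β u = 0 := by
  induction u with
  | nil =>
    rintro c (_ | ⟨b, β⟩) h
    · simp at h
    · rfl
  | cons a u ih =>
    rintro c (_ | ⟨b, β⟩) h
    · simp at h
    · have h1 : ¬ (b :: β).Sublist u := fun h' => h (h'.cons _)
      rw [signedNormalEmbeddings, ih _ _ h1]
      by_cases hb : b = a
      · subst hb
        rw [ih _ β fun h' => h (h'.cons_cons _)]
        simp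
      · simp [hb]

/-! ### Normal embeddings into alternating words. -/

/-- The alternating word `true, false, …, true, false` of length `2 * n`. -/
def alternatingWord : ℕ → List Bool
  | 0 => []
  | n + 1 => true :: false :: alternatingWord n

theorem length_alternatingWord (n : ℕ) : (alternatingWord n).length = 2 * n := by
  induction n with
  | zero => rfl
  | succ n ih => simp [alternatingWord, ih]; ring

theorem getElem_alternatingWord (n i : ℕ) (h : i < (alternatingWord n).length) :
    (alternatingWord n)[i] = decide (i % 2 = 0) := by
  induction n generalizing i with
  | zero => simp [alternatingWord] at h
  | succ n ih =>
    rcases i with _ | _ | i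
    · simp [alternatingWord]
    · simp [alternatingWord]
    · simp [alternatingWord, ih]
      omega

theorem signedNormalEmbeddings_nil_alternatingWord (n : ℕ) :
    signedNormalEmbeddings (some false) [] (alternatingWord n) = 1 := by
  induction n with
  | zero => rfl
  | succ n ih => simp [alternatingWord, signedNormalEmbeddings, ih]

theorem signedNormalEmbeddings_singleton_alternatingWord (n : ℕ) :
    signedNormalEmbeddings (some false) [false] (alternatingWord n) = -n := by
  induction n with
  | zero => rfl
  | succ n ih =>
    simp [alternatingWord, signedNormalEmbeddings, ih, signedNormalEmbeddings_nil_alternatingWord]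

/-- If the first block supplies the 1, the 0 comes either from that block (1 way) or from a later
one (`n` ways); otherwise both letters come from the remaining `n` blocks. This is Pascal's rule. -/
theorem signedNormalEmbeddings_pair_alternatingWord (n : ℕ) :
    signedNormalEmbeddings (some false) [true, false] (alternatingWord n) = (n + 1).choose 2 := by
  induction n with
  | zero => rfl
  | succ n ih =>
    have : (n + 1 + 1).choose 2 = (n + 1) + (n + 1).choose 2 := by
      rw [Nat.choose_succ_succ' (n + 1) 1, Nat.choose_one_right]
    rw [this]
    simp [alternatingWord, signedNormalEmbeddings, ih, signedNormalEmbeddings_nil_alternatingWord,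
      signedNormalEmbeddings_singleton_alternatingWord]
    ring

theorem signedNormalEmbeddings_none_alternatingWord (n : ℕ) :
    signedNormalEmbeddings none [true, false] (alternatingWord n) = (n + 1).choose 2 := by
  rw [← signedNormalEmbeddings_pair_alternatingWord]
  cases n <;> simp [alternatingWord, signedNormalEmbeddings]

/-! ### Permutations encoded by binary words. -/

namespace FinPermutation

/-- The permutation whose one-line notation lists the indices of the letters `false` of the word
`w`, and then those of the letters `true`, each in increasing order. -/
def ofWord (w : List Bool) (hw : w ≠ []) : FinPermutation where
  length := w.length
  length_pos := List.length_pos_iff.2 hw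
  perm := Tuple.sort w.get

theorem sort_symm_lt_iff {n : ℕ} (f : Fin n → Bool) (a b : Fin n) :
    (Tuple.sort f).symm a < (Tuple.sort f).symm b ↔ f a < f b ∨ f a = f b ∧ a < b := by
  obtain ⟨hm, hs⟩ := Tuple.eq_sort_iff.1 (rfl : Tuple.sort f = Tuple.sort f)
  have key : ∀ a b, (Tuple.sort f).symm a < (Tuple.sort f).symm b →
      f a < f b ∨ f a = f b ∧ a < b := by
    intro a b h
    have h1 : f a ≤ f b := by simpa using hm h.le
    rcases h1.lt_or_eq with h1 | h1
    · exact Or.inl h1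
    · exact Or.inr ⟨h1, by simpa using hs _ _ h (by simpa using h1)⟩
  refine ⟨key a b, fun h => ?_⟩
  by_contra hlt
  rcases (not_lt.1 hlt).lt_or_eq with h' | h'
  · rcases h with h | ⟨h, h3⟩ <;> rcases key _ _ h' with h2 | ⟨h2, h4⟩
    · exact lt_asymm h h2
    · exact h.ne h2.symm
    · exact h2.ne h.symm
    · exact lt_asymm h3 h4
  · have := (Tuple.sort f).symm.injective h'
    subst this
    simp at h

theorem ofWord_symm_lt_iff (w : List Bool) (hw : w ≠ []) (a b : Fin w.length) :
    (ofWord w hw).perm.symm a < (ofWord w hw).perm.symm b ↔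
      w.get a < w.get b ∨ w.get a = w.get b ∧ a < b :=
  sort_symm_lt_iff w.get a b

/-- Pattern containment expressed through the positions of letters. -/
theorem le_iff_symm {σ π : FinPermutation} : σ ≤ π ↔ ∃ f : Fin σ.length ↪o Fin π.length,
    ∀ a b, σ.perm.symm a < σ.perm.symm b ↔ π.perm.symm (f a) < π.perm.symm (f b) := by
  constructor
  · rintro ⟨e, he⟩
    have hm : StrictMono fun a => π.perm (e (σ.perm.symm a)) :=
      fun a b hab => (he _ _).1 (by simpa using hab)
    exact ⟨OrderEmbedding.ofStrictMono _ hm, fun a b => by simp⟩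
  · rintro ⟨f, hf⟩
    have hm : StrictMono fun i => π.perm.symm (f (σ.perm i)) :=
      fun a b hab => (hf _ _).1 (by simpa using hab)
    exact ⟨OrderEmbedding.ofStrictMono _ hm, fun a b => by simp⟩

/-- The relative order of the positions of the letters determines a permutation; antisymmetry of
containment avoids transporting `perm` along `hl`. -/
theorem eq_ofWord {σ : FinPermutation} {w : List Bool} (hw : w ≠ []) (hl : w.length = σ.length)
    (h : ∀ a b : Fin σ.length, σ.perm.symm a < σ.perm.symm b ↔
      w.get (a.cast hl.symm) < w.get (b.cast hl.symm) ∨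
        w.get (a.cast hl.symm) = w.get (b.cast hl.symm) ∧ a < b) : σ = ofWord w hw := by
  refine le_antisymm (le_iff_symm.2 ⟨(Fin.castOrderIso hl.symm).toOrderEmbedding, fun a b => ?_⟩)
    (le_iff_symm.2 ⟨(Fin.castOrderIso hl).toOrderEmbedding, fun a b => ?_⟩)
  · exact (h a b).trans (ofWord_symm_lt_iff w hw (a.cast hl.symm) (b.cast hl.symm)).symm
  · exact (ofWord_symm_lt_iff w hw a b).trans (h (a.cast hl) (b.cast hl)).symm

theorem ofWord_mono {u w : List Bool} (hu : u ≠ []) (hw : w ≠ []) (h : u.Sublist w) :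
    ofWord u hu ≤ ofWord w hw := by
  obtain ⟨f, hf⟩ := List.sublist_iff_exists_fin_orderEmbedding_get_eq.1 h
  refine le_iff_symm.2 ⟨f, fun (a b : Fin u.length) => ?_⟩
  refine (ofWord_symm_lt_iff u hu a b).trans
    (Iff.trans ?_ (ofWord_symm_lt_iff w hw (f a) (f b)).symm)
  rw [hf, hf, f.lt_iff_lt]

theorem exists_sublist_of_le_ofWord {σ : FinPermutation} {w : List Bool} {hw : w ≠ []}
    (h : σ ≤ ofWord w hw) : ∃ (u : List Bool) (hu : u ≠ []), u.Sublist w ∧ σ = ofWord u hu := by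
  obtain ⟨(f : Fin σ.length ↪o Fin w.length), hf⟩ := le_iff_symm.1 h
  have hl : (List.ofFn fun a => w.get (f a)).length = σ.length := by simp
  have hu : (List.ofFn fun a => w.get (f a)) ≠ [] := by
    rw [← List.length_pos_iff, hl]
    exact σ.length_pos
  refine ⟨_, hu, ?_, eq_ofWord hu hl fun a b => ?_⟩
  · refine List.sublist_iff_exists_fin_orderEmbedding_get_eq.2
      ⟨(Fin.castOrderIso hl).toOrderEmbedding.trans f, fun i => ?_⟩
    simp
    rfl
  · rw [hf]
    refine (ofWord_symm_lt_iff w hw (f a) (f b)).trans ?_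
    rw [f.lt_iff_lt]
    simp

theorem pair_sublist_iff {w : List Bool} : [true, false].Sublist w ↔
    ∃ a b : Fin w.length, a < b ∧ w.get a = true ∧ w.get b = false := by
  rw [List.sublist_iff_exists_fin_orderEmbedding_get_eq]
  constructor
  · rintro ⟨f, hf⟩
    refine ⟨f ⟨0, by simp⟩, f ⟨1, by simp⟩, f.lt_iff_lt.2 Nat.zero_lt_one, ?_, ?_⟩
    · rw [← hf]; rfl
    · rw [← hf]; rfl
  · rintro ⟨a, b, hab, ha, hb⟩
    refine ⟨OrderEmbedding.ofStrictMono ![a, b] ?_, ?_⟩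
    · intro i j hij
      change Fin 2 at i j
      fin_cases i <;> fin_cases j <;> simp_all
    · intro i
      change Fin 2 at i
      fin_cases i
      · exact ha.symm
      · exact hb.symm

/-- A word that contains `true, false` is determined by its permutation. -/
theorem ofWord_injective {u w : List Bool} {hu : u ≠ []} {hw : w ≠ []}
    (h : [true, false].Sublist u) (he : ofWord u hu = ofWord w hw) : u = w := by
  have hl : u.length = w.length := congrArg FinPermutation.length he
  have hinv : ∀ a b : Fin u.length, a < b → (u.get a = true ∧ u.get b = false ↔
      w.get (a.cast hl) = true ∧ w.get (b.cast hl) = false) := by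
    -- The right-hand permutation is made a variable so that the equality can be eliminated despite
    -- the dependent type of `perm`.
    have aux : ∀ σ : FinPermutation, ∀ e : ofWord u hu = σ, ∀ a b : Fin u.length,
        ((ofWord u hu).perm.symm b < (ofWord u hu).perm.symm a ↔
          σ.perm.symm (b.cast (congrArg FinPermutation.length e)) <
            σ.perm.symm (a.cast (congrArg FinPermutation.length e))) := by
      rintro σ rfl a b
      rfl
    intro a b hab
    have h1 := (ofWord_symm_lt_iff u hu b a).symm.trans
      ((aux _ he a b).trans (ofWord_symm_lt_iff w hw (b.cast hl) (a.cast hl)))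
    have h2 : ¬ b < a := hab.asymm
    have h3 : ¬ (b.cast hl < a.cast hl) := h2
    simp only [h2, h3, and_false, or_false, Bool.lt_iff] at h1
    tauto
  obtain ⟨a, b, hab, ha, hb⟩ := pair_sublist_iff.1 h
  obtain ⟨ha', hb'⟩ := (hinv a b hab).1 ⟨ha, hb⟩
  -- Inversions are the pairs 1…0. With the inversion (`a`, `b`) fixed, the letter at `c < b` is 1
  -- iff (`c`, `b`) is an inversion, and the letter at `c ≥ b` is 0 iff (`a`, `c`) is one.
  have hg : ∀ c : Fin u.length, u.get c = w.get (c.cast hl) := by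
    intro c
    rcases lt_or_ge c b with hc | hc
    · have := hinv c b hc
      rw [Bool.eq_iff_iff]
      tauto
    · have := hinv a c (hab.trans_le hc)
      rw [← Bool.not_inj_iff, Bool.eq_iff_iff, Bool.not_eq_true', Bool.not_eq_true']
      tauto
  exact List.ext_get hl fun i h1 h2 => hg ⟨i, h1⟩

/-! ### Transfer of the Möbius function from permutations to words. -/

/-- The permutation `2 1`. -/
def descent : FinPermutation := ofWord [true, false] (by simp)

theorem descent_le_ofWord_iff {w : List Bool} (hw : w ≠ []) :
    descent ≤ ofWord w hw ↔ [true, false].Sublist w := by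
  constructor
  · intro h
    obtain ⟨u, hu, huw, he⟩ := exists_sublist_of_le_ofWord h
    rwa [ofWord_injective (List.Sublist.refl _) he]
  · exact ofWord_mono _ _

theorem one_le (σ : FinPermutation) : 1 ≤ σ := by
  have : Subsingleton (Fin (1 : FinPermutation).length) := inferInstanceAs (Subsingleton (Fin 1))
  refine ⟨OrderEmbedding.ofStrictMono (fun _ => ⟨0, σ.length_pos⟩) ?_, ?_⟩
  · intro a b h
    exact absurd (Subsingleton.elim a b) h.ne
  · intro a b
    simp [Subsingleton.elim a b]

/-- The permutations without descents form a chain. -/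
theorem le_of_not_descent_le {σ τ : FinPermutation} (hσ : ¬ descent ≤ σ) (hτ : ¬ descent ≤ τ)
    (h : σ.length ≤ τ.length) : σ ≤ τ := by
  have key : ∀ σ : FinPermutation, ¬ descent ≤ σ → ∀ i j, σ.perm i < σ.perm j ↔ i < j := by
    intro σ hσ
    have hm : StrictMono σ.perm := by
      intro i j hij
      by_contra hji
      have hji := (not_lt.1 hji).lt_of_ne (σ.perm.injective.ne hij.ne')
      -- The two letters of an inversion, in increasing order of size, form an occurrence of 21.
      have hf : StrictMono (![σ.perm j, σ.perm i] : Fin 2 → Fin σ.length) := by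
        intro a b hab
        fin_cases a <;> fin_cases b <;> simp_all
      refine hσ (le_iff_symm.2 ⟨OrderEmbedding.ofStrictMono _ hf, fun (a b : Fin 2) => ?_⟩)
      refine (ofWord_symm_lt_iff [true, false] (by simp) a b).trans ?_
      change _ ↔ σ.perm.symm (![σ.perm j, σ.perm i] a) < σ.perm.symm (![σ.perm j, σ.perm i] b)
      fin_cases a <;> fin_cases b <;> simp [hij, hij.asymm, Bool.lt_iff]
    exact fun i j => hm.lt_iff_lt
  refine ⟨Fin.castLEOrderEmb h, fun i j => ?_⟩
  rw [key σ hσ, key τ hτ, OrderEmbedding.lt_iff_lt]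

noncomputable instance : DecidableLE FinPermutation := Classical.decRel _

/-- The 21-avoiders below `π` form an interval `[1, m]` of the chain, with `m` the longest of them.
The witness `τ` ensures `m ≠ 1`, so the Möbius sum vanishes. -/
theorem sum_mu_not_descent_le {π τ : FinPermutation} (hτ : ¬ descent ≤ τ) (hτπ : τ ≤ π)
    (hτ1 : τ ≠ 1) :
    ∑ z ∈ (Finset.Icc 1 π).filter (fun z => ¬ descent ≤ z), mobius z = 0 := by
  have hne : ((Finset.Icc 1 π).filter (fun z => ¬ descent ≤ z)).Nonempty :=
    ⟨τ, by simp [one_le, hτ, hτπ]⟩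
  obtain ⟨m, hm, hmax⟩ := Finset.exists_max_image _ length hne
  have hm' := Finset.mem_filter.1 hm
  have heq : (Finset.Icc 1 π).filter (fun z => ¬ descent ≤ z) = Finset.Icc 1 m := by
    ext z
    constructor
    · intro hz
      exact Finset.mem_Icc.2 ⟨one_le z,
        le_of_not_descent_le (Finset.mem_filter.1 hz).2 hm'.2 (hmax z hz)⟩
    · intro hz
      have hzm := (Finset.mem_Icc.1 hz).2
      exact Finset.mem_filter.2 ⟨Finset.mem_Icc.2 ⟨one_le z, hzm.trans (Finset.mem_Icc.1 hm'.1).2⟩,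
        fun h => hm'.2 (h.trans hzm)⟩
  have hm1 : (1 : FinPermutation) ≠ m := by
    rintro rfl
    have : τ ∈ Finset.Icc (1 : FinPermutation) 1 := heq ▸ (by simp [one_le, hτ, hτπ])
    exact hτ1 (by simpa using this)
  rw [heq]
  exact (IncidenceAlgebra.sum_Icc_mu_right (𝕜 := ℤ) 1 m).trans (if_neg hm1)

theorem sum_mu_not_descent_le_ofWord {w : List Bool} (hw : w ≠ []) (h : [true, false].Sublist w) :
    ∑ z ∈ (Finset.Icc 1 (ofWord w hw)).filter (fun z => ¬ descent ≤ z), mobius z =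
      if w = [true, false] then 1 else 0 := by
  split_ifs with hw2
  · subst hw2
    have heq : (Finset.Icc 1 (ofWord [true, false] hw)).filter (fun z => ¬ descent ≤ z) = {1} := by
      ext z
      rw [Finset.mem_filter, Finset.mem_Icc, Finset.mem_singleton]
      constructor
      · rintro ⟨⟨-, hz⟩, hd⟩
        obtain ⟨u, hu, hus, rfl⟩ := exists_sublist_of_le_ofWord hz
        have hl : u.length ≤ 1 := by
          by_contra hl
          have := hus.eq_of_length_le (by simp; omega)
          subst this
          exact hd le_rfl
        refine le_antisymm (le_of_not_descent_le hd (fun h1 => ?_) hl) (one_le _)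
        have := length_le h1
        revert this
        decide
      · rintro rfl
        refine ⟨⟨le_rfl, one_le _⟩, fun h1 => ?_⟩
        have := length_le h1
        revert this
        decide
    rw [heq, Finset.sum_singleton]
    simp [mobius]
  -- A subword of length two other than 10 yields the pattern 12, which serves as `τ`. Among three
  -- letters `x y z`, the pairs `x y` and `y z` cannot both be 10.
  · have hsub : ∃ a b, [a, b].Sublist w ∧ ¬ (a = true ∧ b = false) := by
      rcases w with _ | ⟨x, _ | ⟨y, _ | ⟨z, w⟩⟩⟩
      · simp at hw
      · simpa using h.length_le
      · exact absurd (h.eq_of_length rfl).symm hw2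
      · by_cases hxy : x = true ∧ y = false
        · exact ⟨y, z, by simp, by simp [hxy.2]⟩
        · exact ⟨x, y, by simp, hxy⟩
    obtain ⟨a, b, hs, hab⟩ := hsub
    refine sum_mu_not_descent_le (τ := ofWord [a, b] (by simp)) ?_ (ofWord_mono _ _ hs) ?_
    · rw [descent_le_ofWord_iff]
      intro h'
      have := h'.eq_of_length rfl
      simp_all
    · intro h'
      have : (2 : ℕ) = 1 := congrArg length h'
      omega

theorem ne_nil_of_pair_sublist {w : List Bool} (h : [true, false].Sublist w) : w ≠ [] := by
  rintro rfl
  simp at h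

theorem sum_mu_descent_le (F : List Bool → ℤ)
    (hF : ∀ u (hu : u ≠ []), [true, false].Sublist u → F u = (ofWord u hu).mobius)
    {w : List Bool} (hw : w ≠ []) :
    ∑ z ∈ (Finset.Icc 1 (ofWord w hw)).filter (fun z => descent ≤ z), mobius z =
      ∑ u ∈ (subwords w).filter (fun u => [true, false].Sublist u), F u := by
  symm
  refine Finset.sum_bij
    (fun u hu => ofWord u (ne_nil_of_pair_sublist (Finset.mem_filter.1 hu).2)) ?_ ?_ ?_ ?_
  · intro u hu
    rw [Finset.mem_filter, mem_subwords] at hu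
    exact Finset.mem_filter.2 ⟨Finset.mem_Icc.2 ⟨one_le _, ofWord_mono _ _ hu.1⟩,
      (descent_le_ofWord_iff _).2 hu.2⟩
  · intro u hu v hv he
    exact ofWord_injective (Finset.mem_filter.1 hu).2 he
  · intro z hz
    rw [Finset.mem_filter, Finset.mem_Icc] at hz
    obtain ⟨u, hu, hus, rfl⟩ := exists_sublist_of_le_ofWord hz.1.2
    exact ⟨u, Finset.mem_filter.2 ⟨mem_subwords.2 hus, (descent_le_ofWord_iff _).1 hz.2⟩, rfl⟩
  · intro u hu
    exact hF _ _ (Finset.mem_filter.1 hu).2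

theorem mobius_ofWord (w : List Bool) (hw : w ≠ []) (h : [true, false].Sublist w) :
    (ofWord w hw).mobius = -signedNormalEmbeddings none [true, false] w := by
  induction hn : w.length using Nat.strong_induction_on generalizing w with
  | _ n ih =>
    subst hn
    -- The value 0 at the empty word is never used, because that word does not contain 10.
    let F : List Bool → ℤ := fun u => if hu : u ≠ [] then (ofWord u hu).mobius else 0
    have hF : ∀ u (hu : u ≠ []), [true, false].Sublist u → F u = (ofWord u hu).mobius :=
      fun u hu _ => dif_pos hu
    have h1 : ∑ z ∈ Finset.Icc 1 (ofWord w hw), mobius z = 0 := by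
      refine (IncidenceAlgebra.sum_Icc_mu_right (𝕜 := ℤ) 1 (ofWord w hw)).trans (if_neg fun he => ?_)
      have h2 := h.length_le
      have h3 : 1 = w.length := congrArg length he
      simp at h2
      omega
    rw [← Finset.sum_filter_add_sum_filter_not _ (fun z => descent ≤ z),
      sum_mu_not_descent_le_ofWord hw h, sum_mu_descent_le F hF hw] at h1
    have h2 := sum_signedNormalEmbeddings [true, false] w
    rw [← Finset.sum_filter_of_ne (p := fun u => [true, false].Sublist u) fun u _ hu => by
      by_contra h'
      exact hu (signedNormalEmbeddings_eq_zero u _ _ h')] at h2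
    -- Both indicators of `w` = 10 cancel, leaving a sum of `F u + signedNormalEmbeddings none
    -- [true, false] u`; by induction only the term `u = w` survives.
    rw [← h2, ← Finset.sum_add_distrib, Finset.sum_eq_single w] at h1
    · rw [hF w hw h] at h1
      linarith
    · intro u hu huw
      rw [Finset.mem_filter, mem_subwords] at hu
      have hlt : u.length < w.length := by
        refine hu.1.length_le.lt_of_ne fun h' => huw (hu.1.eq_of_length h')
      rw [hF u (ne_nil_of_pair_sublist hu.2) hu.2, ih _ hlt u _ hu.2 rfl]
      ring
    · intro h'
      exact absurd (Finset.mem_filter.2 ⟨mem_subwords.2 (List.Sublist.refl w), h⟩) h'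

/-! ### The permutations `M_n` and unboundedness. -/

theorem alternatingWord_ne_nil {n : ℕ} (hn : 1 ≤ n) : alternatingWord n ≠ [] := by
  rw [← List.length_pos_iff, length_alternatingWord]
  omega

theorem evensThenOdds_symm_apply_val {n : ℕ} (hn : 1 ≤ n)
    (v : Fin (evensThenOdds n hn).length) :
    ((evensThenOdds n hn).perm.symm v : ℕ) =
      if (v : ℕ) % 2 = 1 then (v : ℕ) / 2 else n + (v : ℕ) / 2 := by
  change ((if (v : ℕ) % 2 = 1 then ⟨v / 2, _⟩ else ⟨n + v / 2, _⟩ : Fin (2 * n)) : ℕ) = _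
  split_ifs <;> rfl

theorem evensThenOdds_eq_ofWord {n : ℕ} (hn : 1 ≤ n) :
    evensThenOdds n hn = ofWord (alternatingWord n) (alternatingWord_ne_nil hn) := by
  refine eq_ofWord _ (length_alternatingWord n) fun a b => ?_
  have ha : (a : ℕ) < 2 * n := a.2
  have hb : (b : ℕ) < 2 * n := b.2
  rw [Fin.lt_def, evensThenOdds_symm_apply_val, evensThenOdds_symm_apply_val]
  simp only [List.get_eq_getElem, getElem_alternatingWord, Fin.val_cast, Bool.lt_iff,
    decide_eq_false_iff_not, decide_eq_true_eq, decide_eq_decide, Fin.lt_def]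
  split_ifs <;> omega

theorem mobius_evensThenOdds (n : ℕ) (hn : 1 ≤ n) :
    (evensThenOdds n hn).mobius = -((n + 1).choose 2 : ℤ) := by
  rw [evensThenOdds_eq_ofWord, mobius_ofWord, signedNormalEmbeddings_none_alternatingWord]
  obtain ⟨m, rfl⟩ : ∃ m, n = m + 1 := ⟨n - 1, by omega⟩
  simp [alternatingWord]

end FinPermutation

theorem mainTheorem2 :
    (∀ B : ℤ, ∃ π : FinPermutation, B < |π.mobius|) ∧
    (∀ (n : ℕ) (hn : 1 ≤ n),
      (FinPermutation.evensThenOdds n hn).mobius = -((n + 1).choose 2 : ℤ)) := by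
  refine ⟨fun B => ?_, FinPermutation.mobius_evensThenOdds⟩
  refine ⟨FinPermutation.evensThenOdds (B.toNat + 1) (by omega), ?_⟩
  rw [FinPermutation.mobius_evensThenOdds, abs_neg, Nat.abs_cast]
  -- With n = `B.toNat + 1`, the bound is C(n+1, 2) = n + C(n, 2) ≥ n > `B`.
  have h : B.toNat + 1 ≤ (B.toNat + 1 + 1).choose 2 := by
    rw [Nat.choose_succ_succ' (B.toNat + 1) 1, Nat.choose_one_right]
    omega
  have := Int.self_le_toNat B
  omega
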